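/- Let $\mathcal L_{\mathsf{pf}}$ be the bimodal propositional language with countably many propositional variables, the connectives $\neg,\land,\lor,\to$, and two unary modal operators $\Box_{\mathsf p}$ and $\Box_{\mathsf f}$; write $\Diamond_{\mathsf p}=\neg\Box_{\mathsf p}\neg$ and $\Diamond_{\mathsf f}=\neg\Box_{\mathsf f}\neg$. Let $\mathbf{PF}$ be the logic in $\mathcal L_{\mathsf{pf}}$ whose axioms are all propositional tautologies in $\mathcal L_{\mathsf{pf}}$ (boxed formulas being treated as atoms) and, for all $\mathcal L_{\mathsf{pf}}$-formulas $A,B$, 1. (axioms of $\mathbf{GL}$ for $\Box_{\mathsf p}$) $\Box_{\mathsf p}(A\to B)\to(\Box_{\mathsf p}A\to\Box_{\mathsf p}B)$ and $\Box_{\mathsf p}(\Box_{\mathsf p}A\to A)\to\Box_{\mathsf p}A$; 2. (axioms of $\mathbf{S4.2}$ for $\Box_{\mathsf f}$) $\Box_{\mathsf f}(A\to B)\to(\Box_{\mathsf f}A\to\Box_{\mathsf f}B)$, $\Box_{\mathsf f}A\to A$, $\Box_{\mathsf f}A\to\Box_{\mathsf f}\Box_{\mathsf f}A$ and $\Diamond_{\mathsf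 f}\Box_{\mathsf f}A\to\Box_{\mathsf f}\Diamond_{\mathsf f}A$; 3. (interaction axioms) $\Box_{\mathsf p}A\to\Box_{\mathsf f}\Box_{\mathsf p}A$, $\Diamond_{\mathsf p}A\to\Box_{\mathsf f}\Diamond_{\mathsf p}A$ and $\Box_{\mathsf p}A\to\Box_{\mathsf p}\Box_{\mathsf f}A$; and whose inference rules are modus ponens and necessitation for both operators (from $A$ infer $\Box_{\mathsf p}A$; from $A$ infer $\Box_{\mathsf f}A$). Then $\mathbf{PF}$ is decidable: under a standard Gödel numbering of $\mathcal L_{\mathsf{pf}}$-formulas, there is a computable (total recursive) function that decides, given an $\mathcal L_{\mathsf{pf}}$-formula $A$, whether $\mathbf{PF}\vdash A$. -/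

import Mathlib

namespace ModalPF

/-- Formulas of the bimodal propositional language with countably many propositional variables,
the connectives `¬, ∧, ∨, →` and two unary modal operators `□ₚ` and `□_f`. -/
inductive Formula : Type
  | var (n : ℕ) : Formula
  | neg (A : Formula) : Formula
  | and (A B : Formula) : Formula
  | or (A B : Formula) : Formula
  | imp (A B : Formula) : Formula
  | boxP (A : Formula) : Formula
  | boxF (A : Formula) : Formula

namespace Formula

/-- `◇ₚ A` abbreviates `¬ □ₚ ¬ A`. -/
def diaP (A : Formula) : Formula := neg (boxP (neg A))

/-- `◇_f A` abbreviates `¬ □_f ¬ A`. -/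
def diaF (A : Formula) : Formula := neg (boxF (neg A))

/-- Truth value of a formula under a Boolean assignment `v` to the propositional variables and to
the boxed formulas; the latter are treated as propositional atoms. -/
def truth (v : Formula → Bool) : Formula → Bool
  | var n => v (var n)
  | neg A => !(truth v A)
  | and A B => truth v A && truth v B
  | or A B => truth v A || truth v B
  | imp A B => !(truth v A) || truth v B
  | boxP A => v (boxP A)
  | boxF A => v (boxF A)

/-- Propositional tautologies in the bimodal language. -/
def IsTautology (A : Formula) : Prop := ∀ v : Formula → Bool, truth v A = true

/-- Gödel numbering of formulas, by means of the primitive recursive pairing function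
`Nat.pair`. -/
def code : Formula → ℕ
  | var n => 7 * n
  | neg A => 7 * code A + 1
  | and A B => 7 * Nat.pair (code A) (code B) + 2
  | or A B => 7 * Nat.pair (code A) (code B) + 3
  | imp A B => 7 * Nat.pair (code A) (code B) + 4
  | boxP A => 7 * code A + 5
  | boxF A => 7 * code A + 6

theorem code_injective : Function.Injective code := by
  intro A
  induction A with
  | var n => intro B h; cases B <;> simp only [code] at h <;> first | omega | (congr 1; omega)
  | neg A ih =>
    intro B h
    cases B <;> simp only [code] at h <;> first | omega | (congr 1; exact ih (by omega))
  | boxP A ih =>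
    intro B h
    cases B <;> simp only [code] at h <;> first | omega | (congr 1; exact ih (by omega))
  | boxF A ih =>
    intro B h
    cases B <;> simp only [code] at h <;> first | omega | (congr 1; exact ih (by omega))
  | and A A' ih ih' =>
    intro B h
    cases B <;> simp only [code] at h <;> first
      | omega
      | (have h' := Nat.pair_eq_pair.mp
           (Nat.eq_of_mul_eq_mul_left (by norm_num : 0 < 7) (Nat.add_right_cancel h))
         rw [ih h'.1, ih' h'.2])
  | or A A' ih ih' =>
    intro B h
    cases B <;> simp only [code] at h <;> first
      | omega
      | (have h' := Nat.pair_eq_pair.mp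
           (Nat.eq_of_mul_eq_mul_left (by norm_num : 0 < 7) (Nat.add_right_cancel h))
         rw [ih h'.1, ih' h'.2])
  | imp A A' ih ih' =>
    intro B h
    cases B <;> simp only [code] at h <;> first
      | omega
      | (have h' := Nat.pair_eq_pair.mp
           (Nat.eq_of_mul_eq_mul_left (by norm_num : 0 < 7) (Nat.add_right_cancel h))
         rw [ih h'.1, ih' h'.2])

theorem code_surjective : Function.Surjective code := by
  intro n
  induction n using Nat.strong_induction_on with
  | _ n ih =>
    have hl := Nat.unpair_left_le (n / 7)
    have hr := Nat.unpair_right_le (n / 7)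
    have hlt : n % 7 < 7 := Nat.mod_lt _ (by norm_num)
    have hn := Nat.div_add_mod n 7
    by_cases h0 : n % 7 = 0
    · exact ⟨var (n / 7), by simp only [code]; omega⟩
    obtain ⟨C, hC⟩ := ih (n / 7) (by omega)
    obtain ⟨A, hA⟩ := ih (n / 7).unpair.1 (by omega)
    obtain ⟨B, hB⟩ := ih (n / 7).unpair.2 (by omega)
    have hp : Nat.pair (code A) (code B) = n / 7 := by rw [hA, hB, Nat.pair_unpair]
    have hcases : n % 7 = 1 ∨ n % 7 = 2 ∨ n % 7 = 3 ∨ n % 7 = 4 ∨ n % 7 = 5 ∨ n % 7 = 6 := by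
      omega
    rcases hcases with h | h | h | h | h | h
    · exact ⟨neg C, by simp only [code]; omega⟩
    · exact ⟨and A B, by simp only [code]; omega⟩
    · exact ⟨or A B, by simp only [code]; omega⟩
    · exact ⟨imp A B, by simp only [code]; omega⟩
    · exact ⟨boxP C, by simp only [code]; omega⟩
    · exact ⟨boxF C, by simp only [code]; omega⟩

/-- Formulas are encoded as natural numbers by the Gödel numbering `code`. This also fixes the
notion of a computable function or predicate on formulas. -/
noncomputable instance : Denumerable Formula :=
  Denumerable.mk' (Equiv.ofBijective code ⟨code_injective, code_surjective⟩)

theorem encode_eq_code (A : Formula) : Encodable.encode A = code A := rfl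

end Formula

open Formula in
/-- `Provable A` means `PF ⊢ A`: derivability in the Hilbert-style bimodal logic `PF`. -/
inductive Provable : Formula → Prop
  /-- All propositional tautologies in the bimodal language. -/
  | taut (A : Formula) (h : IsTautology A) : Provable A
  /-- Axioms of `GL` for `□ₚ`. -/
  | kP (A B : Formula) : Provable (imp (boxP (imp A B)) (imp (boxP A) (boxP B)))
  | loeb (A : Formula) : Provable (imp (boxP (imp (boxP A) A)) (boxP A))
  /-- Axioms of `S4.2` for `□_f`. -/
  | kF (A B : Formula) : Provable (imp (boxF (imp A B)) (imp (boxF A) (boxF B)))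
  | tF (A : Formula) : Provable (imp (boxF A) A)
  | fourF (A : Formula) : Provable (imp (boxF A) (boxF (boxF A)))
  | dotTwoF (A : Formula) : Provable (imp (diaF (boxF A)) (boxF (diaF A)))
  /-- Interaction axioms. -/
  | boxPboxF (A : Formula) : Provable (imp (boxP A) (boxF (boxP A)))
  | diaPboxF (A : Formula) : Provable (imp (diaP A) (boxF (diaP A)))
  | boxPboxPboxF (A : Formula) : Provable (imp (boxP A) (boxP (boxF A)))
  /-- Modus ponens. -/
  | mp (A B : Formula) (hAB : Provable (imp A B)) (hA : Provable A) : Provable B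
  /-- Necessitation for `□ₚ` and `□_f`. -/
  | necP (A : Formula) (h : Provable A) : Provable (boxP A)
  | necF (A : Formula) (h : Provable A) : Provable (boxF A)

end ModalPF

/-! `PF` has an effectively bounded finite model property. For `M = code A + 1`, a world is a bit
string of length `8 * M`: the truth values of the formulas with code below `7 * M`, and those of
`◇_f □_f B` for `code B < M`. A candidate model is a set of such strings, again coded by a number,
and the conditions in `IsModel` quantify only over bounded ranges. Hence `Refutable` is primitive
recursive, and it remains to see that a formula is unprovable iff its code is refutable.

If `A` is refutable, the coded worlds form a Kripke model whose frame validates `PF`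
(`IsModel.provable_forces`) and in which truth is given by the digits (`IsModel.forces_iff`). The
digits for `◇_f □_f B` are there for directedness: they are constant along `□_f`-steps, so one final
world serves all worlds above a common origin.

If `A` is unprovable, a maximal consistent set omits it, and the restrictions of all maximal
consistent sets form a model (`isModel_canonicalModel`). Löb's axiom supplies the `□ₚ`-witnesses,
and the `.2` axiom supplies the final worlds. -/

namespace ModalPF

/-- Local coherence at index `k` of the set of formula codes given by the binary digits of `x`.
Digit `j < 7 * M` is the truth value of the formula with code `j`, and digit `7 * M + k` that of
`◇_f □_f A` for the formula `A` with code `k`. -/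
def Coherent (M x k : ℕ) : Prop :=
  (x.testBit (7 * k + 1) ↔ ¬ x.testBit k) ∧
  (x.testBit (7 * k + 2) ↔ x.testBit k.unpair.1 ∧ x.testBit k.unpair.2) ∧
  (x.testBit (7 * k + 3) ↔ x.testBit k.unpair.1 ∨ x.testBit k.unpair.2) ∧
  (x.testBit (7 * k + 4) ↔ ¬ x.testBit k.unpair.1 ∨ x.testBit k.unpair.2) ∧
  (¬ x.testBit (7 * k + 6) ∨ x.testBit k ∧ x.testBit (7 * M + k))

/-- The accessibility relation for `□_f` at index `k`. -/
def StepF (M x y k : ℕ) : Prop :=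
  (x.testBit (7 * k + 5) ↔ y.testBit (7 * k + 5)) ∧
  (x.testBit (7 * M + k) ↔ y.testBit (7 * M + k)) ∧
  (¬ x.testBit (7 * k + 6) ∨ y.testBit (7 * k + 6))

/-- The weak accessibility relation for `□ₚ` at index `k`. -/
def StepP (x y k : ℕ) : Prop :=
  ¬ x.testBit (7 * k + 5) ∨ y.testBit (7 * k + 5) ∧ y.testBit (7 * k + 6)

/-- Every `□_f` and `□ₚ` formula that is false at `x` has a witness in `V`. -/
def Witnessed (M V x k : ℕ) : Prop :=
  (x.testBit (7 * k + 6) ∨ ∃ y < 2 ^ (8 * M), V.testBit y ∧ ¬ y.testBit k ∧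
    ∀ j < M, StepF M x y j) ∧
  (x.testBit (7 * k + 5) ∨ ∃ y < 2 ^ (8 * M), V.testBit y ∧ ¬ y.testBit k ∧
    y.testBit (7 * k + 5) ∧ ∀ j < M, StepP x y j)

/-- Some world of `V` above `x` makes `□_f A` true whenever `x` makes `◇_f □_f A` true. -/
def HasFinal (M V x : ℕ) : Prop :=
  ∃ y < 2 ^ (8 * M), V.testBit y ∧
    ∀ j < M, StepF M x y j ∧ (¬ y.testBit (7 * M + j) ∨ y.testBit (7 * j + 6))

/-- The binary digits of `V` form the set of worlds of a finite model. -/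
def IsModel (M V : ℕ) : Prop :=
  ∀ x < 2 ^ (8 * M), ¬ V.testBit x ∨
    (∀ k < M, Coherent M x k ∧ Witnessed M V x k) ∧ HasFinal M V x

/-- The formula with code `n` fails in some finite model. -/
def Refutable (n : ℕ) : Prop :=
  ∃ V < 2 ^ 2 ^ (8 * (n + 1)), IsModel (n + 1) V ∧
    ∃ x < 2 ^ (8 * (n + 1)), V.testBit x ∧ ¬ x.testBit n

/-! ### Refutability is primitive recursive -/

section Primrec

variable {α : Type*} [Primcodable α]

theorem primrec_two_pow {f : α → ℕ} (hf : Primrec f) : Primrec fun a => 2 ^ f a := by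
  have h : Primrec fun n : ℕ => Nat.rec (motive := fun _ => ℕ) 1 (fun _ m => m * 2) n :=
    Primrec.nat_rec₁ 1 (Primrec.nat_mul.comp Primrec.snd (Primrec.const 2)).to₂
  refine (h.comp hf).of_eq fun a => ?_
  induction f a with
  | zero => rfl
  | succ n ih => rw [pow_succ, ← ih]

theorem primrec_mul_add {f g : α → ℕ} (m : ℕ) (hf : Primrec f) (hg : Primrec g) :
    Primrec fun a => m * f a + g a :=
  Primrec.nat_add.comp (Primrec.nat_mul.comp (Primrec.const m) hf) hg

theorem primrecPred_testBit {f g : α → ℕ} (hf : Primrec f) (hg : Primrec g) :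
    PrimrecPred fun a => (f a).testBit (g a) = true := by
  have h : Primrec fun a => f a / 2 ^ g a % 2 :=
    Primrec.nat_mod.comp (Primrec.nat_div.comp hf (primrec_two_pow hg)) (Primrec.const 2)
  refine (Primrec.eq.comp h (Primrec.const 1)).of_eq fun a => ?_
  rw [Nat.testBit_eq_decide_div_mod_eq, decide_eq_true_iff]

theorem primrecPred_iff {p q : α → Prop} (hp : PrimrecPred p) (hq : PrimrecPred q) :
    PrimrecPred fun a => (p a ↔ q a) :=
  ((hp.and hq).or (hp.not.and hq.not)).of_eq fun a => by tauto

theorem primrecPred_exists_lt {f : α → ℕ} {p : α → ℕ → Prop} (hf : Primrec f)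
    (hp : PrimrecPred fun q : α × ℕ => p q.1 q.2) : PrimrecPred fun a => ∃ x < f a, p a x := by
  have h : PrimrecRel fun (x : ℕ) (a : α) => p a x :=
    hp.comp (Primrec.snd.pair Primrec.fst)
  exact (h.exists_mem_list.comp (Primrec.list_range.comp hf) Primrec.id).of_eq (by simp)

theorem primrecPred_forall_lt {f : α → ℕ} {p : α → ℕ → Prop} (hf : Primrec f)
    (hp : PrimrecPred fun q : α × ℕ => p q.1 q.2) : PrimrecPred fun a => ∀ x < f a, p a x := by
  have h : PrimrecRel fun (x : ℕ) (a : α) => p a x :=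
    hp.comp (Primrec.snd.pair Primrec.fst)
  exact (h.forall_mem_list.comp (Primrec.list_range.comp hf) Primrec.id).of_eq (by simp)

variable {M V x y k : α → ℕ}

theorem primrecPred_box (i : ℕ) (hx : Primrec x) (hk : Primrec k) :
    PrimrecPred fun a => (x a).testBit (7 * k a + i) = true :=
  primrecPred_testBit hx (primrec_mul_add 7 hk (Primrec.const i))

theorem primrecPred_coherent (hM : Primrec M) (hx : Primrec x) (hk : Primrec k) :
    PrimrecPred fun a => Coherent (M a) (x a) (k a) := by
  have h0 := primrecPred_testBit hx hk
  have h1 := primrecPred_testBit hx (Primrec.fst.comp (Primrec.unpair.comp hk))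
  have h2 := primrecPred_testBit hx (Primrec.snd.comp (Primrec.unpair.comp hk))
  have h3 := primrecPred_testBit hx (primrec_mul_add 7 hM hk)
  have h := fun i => primrecPred_box i hx hk
  exact (primrecPred_iff (h 1) h0.not).and <| (primrecPred_iff (h 2) (h1.and h2)).and <|
    (primrecPred_iff (h 3) (h1.or h2)).and <| (primrecPred_iff (h 4) (h1.not.or h2)).and <|
    (h 6).not.or (h0.and h3)

theorem primrecPred_stepF (hM : Primrec M) (hx : Primrec x) (hy : Primrec y) (hk : Primrec k) :
    PrimrecPred fun a => StepF (M a) (x a) (y a) (k a) :=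
  (primrecPred_iff (primrecPred_box 5 hx hk) (primrecPred_box 5 hy hk)).and <|
    (primrecPred_iff (primrecPred_testBit hx (primrec_mul_add 7 hM hk))
      (primrecPred_testBit hy (primrec_mul_add 7 hM hk))).and <|
    (primrecPred_box 6 hx hk).not.or (primrecPred_box 6 hy hk)

theorem primrecPred_stepP (hx : Primrec x) (hy : Primrec y) (hk : Primrec k) :
    PrimrecPred fun a => StepP (x a) (y a) (k a) :=
  (primrecPred_box 5 hx hk).not.or ((primrecPred_box 5 hy hk).and (primrecPred_box 6 hy hk))

theorem primrec_worlds (hM : Primrec M) : Primrec fun a => 2 ^ (8 * M a) :=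
  primrec_two_pow (Primrec.nat_mul.comp (Primrec.const 8) hM)

theorem primrecPred_witnessed (hM : Primrec M) (hV : Primrec V) (hx : Primrec x)
    (hk : Primrec k) : PrimrecPred fun a => Witnessed (M a) (V a) (x a) (k a) := by
  have up {f : α → ℕ} (hf : Primrec f) : Primrec fun q : α × ℕ => f q.1 := hf.comp Primrec.fst
  have up2 {f : α → ℕ} (hf : Primrec f) : Primrec fun q : (α × ℕ) × ℕ => f q.1.1 :=
    (up hf).comp Primrec.fst
  have hy : Primrec fun q : (α × ℕ) × ℕ => q.1.2 := Primrec.snd.comp Primrec.fst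
  have hVy := primrecPred_testBit (up hV) Primrec.snd
  have hyk := (primrecPred_testBit Primrec.snd (up hk)).not
  refine ((primrecPred_box 6 hx hk).or (primrecPred_exists_lt (primrec_worlds hM) ?_)).and
    ((primrecPred_box 5 hx hk).or (primrecPred_exists_lt (primrec_worlds hM) ?_))
  · exact hVy.and <| hyk.and <| primrecPred_forall_lt (up hM)
      (primrecPred_stepF (up2 hM) (up2 hx) hy Primrec.snd)
  · exact hVy.and <| hyk.and <| (primrecPred_box 5 Primrec.snd (up hk)).and <|
      primrecPred_forall_lt (up hM) (primrecPred_stepP (up2 hx) hy Primrec.snd)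

theorem primrecPred_hasFinal (hM : Primrec M) (hV : Primrec V) (hx : Primrec x) :
    PrimrecPred fun a => HasFinal (M a) (V a) (x a) := by
  have up {f : α → ℕ} (hf : Primrec f) : Primrec fun q : α × ℕ => f q.1 := hf.comp Primrec.fst
  have up2 {f : α → ℕ} (hf : Primrec f) : Primrec fun q : (α × ℕ) × ℕ => f q.1.1 :=
    (up hf).comp Primrec.fst
  have hy : Primrec fun q : (α × ℕ) × ℕ => q.1.2 := Primrec.snd.comp Primrec.fst
  refine primrecPred_exists_lt (primrec_worlds hM) ?_
  refine (primrecPred_testBit (up hV) Primrec.snd).and (primrecPred_forall_lt (up hM) ?_)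
  exact (primrecPred_stepF (up2 hM) (up2 hx) hy Primrec.snd).and <|
    (primrecPred_testBit hy (primrec_mul_add 7 (up2 hM) Primrec.snd)).not.or
      (primrecPred_box 6 hy Primrec.snd)

theorem primrecPred_isModel (hM : Primrec M) (hV : Primrec V) :
    PrimrecPred fun a => IsModel (M a) (V a) := by
  have up {f : α → ℕ} (hf : Primrec f) : Primrec fun q : α × ℕ => f q.1 := hf.comp Primrec.fst
  have up2 {f : α → ℕ} (hf : Primrec f) : Primrec fun q : (α × ℕ) × ℕ => f q.1.1 :=
    (up hf).comp Primrec.fst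
  have hx : Primrec fun q : (α × ℕ) × ℕ => q.1.2 := Primrec.snd.comp Primrec.fst
  refine primrecPred_forall_lt (primrec_worlds hM) ?_
  refine (primrecPred_testBit (up hV) Primrec.snd).not.or (PrimrecPred.and ?_
    (primrecPred_hasFinal (up hM) (up hV) Primrec.snd))
  exact primrecPred_forall_lt (up hM) <| (primrecPred_coherent (up2 hM) hx Primrec.snd).and
    (primrecPred_witnessed (up2 hM) (up2 hV) hx Primrec.snd)

theorem primrecPred_refutable : PrimrecPred Refutable := by
  have hM : Primrec fun n : ℕ => n + 1 := Primrec.succ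
  have hW := primrec_worlds hM
  refine primrecPred_exists_lt (primrec_two_pow hW) ?_
  refine (primrecPred_isModel (hM.comp Primrec.fst) Primrec.snd).and
    (primrecPred_exists_lt (hW.comp Primrec.fst) ?_)
  exact (primrecPred_testBit (Primrec.snd.comp Primrec.fst) Primrec.snd).and
    (primrecPred_testBit Primrec.snd (Primrec.fst.comp Primrec.fst)).not

end Primrec

end ModalPF
-- Kripke semantics and soundness
namespace ModalPF

open Formula

section Kripke

variable {W : Type*} (R S : W → W → Prop) (val : W → ℕ → Prop)

/-- Truth of a formula at a world of a Kripke model with relations `R` for `□ₚ` and `S` for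
`□_f`. -/
def Forces : W → Formula → Prop
  | w, .var n => val w n
  | w, .neg A => ¬ Forces w A
  | w, .and A B => Forces w A ∧ Forces w B
  | w, .or A B => Forces w A ∨ Forces w B
  | w, .imp A B => Forces w A → Forces w B
  | w, .boxP A => ∀ u, R w u → Forces u A
  | w, .boxF A => ∀ u, S w u → Forces u A

open Classical in
theorem truth_forces (w : W) (A : Formula) :
    truth (fun B => decide (Forces R S val w B)) A = true ↔ Forces R S val w A := by
  induction A with
  | var | boxP | boxF => simp [truth]
  | neg A ih => simp [truth, Forces, ← ih]
  | and A B ihA ihB | or A B ihA ihB => simp [truth, Forces, ← ihA, ← ihB]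
  | imp A B ihA ihB => simp [truth, Forces, ← ihA, ← ihB, imp_iff_not_or]

variable {R S val}

/-- Soundness of `PF` for its Kripke frames. -/
theorem Provable.forces (Rtrans : ∀ x y z, R x y → R y z → R x z)
    (Rwf : WellFounded fun y x => R x y) (Srefl : ∀ x, S x x)
    (Strans : ∀ x y z, S x y → S y z → S x z)
    (Sdir : ∀ x y z, S x y → S x z → ∃ w, S y w ∧ S z w)
    (SR : ∀ x y z, S x y → (R x z ↔ R y z)) (RS : ∀ x y z, R x y → S y z → R x z)
    {A : Formula} (h : Provable A) (w : W) : Forces R S val w A := by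
  induction h generalizing w with
  | taut A h => exact (truth_forces R S val w A).1 (h _)
  | kP A B => exact fun h1 h2 u hu => h1 u hu (h2 u hu)
  | loeb A =>
    intro h u
    -- Induction from the `R`-later worlds back; transitivity keeps the successors of `u` among
    -- those of `w`.
    induction u using Rwf.induction with
    | _ u ih => exact fun hu => h u hu fun v hv => ih v hv (Rtrans _ _ _ hu hv)
  | kF A B => exact fun h1 h2 u hu => h1 u hu (h2 u hu)
  | tF A => exact fun h => h w (Srefl w)
  | fourF A => exact fun h u hu v hv => h v (Strans _ _ _ hu hv)
  | dotTwoF A =>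
    intro h u hu hn
    refine h fun v hv hA => ?_
    obtain ⟨z, huz, hvz⟩ := Sdir _ _ _ hu hv
    exact hn z huz (hA z hvz)
  | boxPboxF A => exact fun h u hu v hv => h v ((SR _ _ _ hu).2 hv)
  | diaPboxF A => exact fun h u hu hn => h fun v hv => hn v ((SR _ _ _ hu).1 hv)
  | boxPboxPboxF A => exact fun h u hu v hv => h v (RS _ _ _ hu hv)
  | mp A B _ _ hAB hA => exact hAB w (hA w)
  | necP A _ ih => exact fun u _ => ih u
  | necF A _ ih => exact fun u _ => ih u

end Kripke

/-! ### The Kripke model of a coded set of worlds -/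

section Model

variable {M V : ℕ}

/-- The worlds coded by `V`. -/
abbrev World (M V : ℕ) : Type := {x : ℕ // x < 2 ^ (8 * M) ∧ V.testBit x = true}

/-- The accessibility relation for `□_f` in the model coded by `V`. -/
def AccF (x y : World M V) : Prop := ∀ k < M, StepF M x y k

/-- The accessibility relation for `□ₚ` in the model coded by `V`. -/
def AccP (x y : World M V) : Prop :=
  (∀ k < M, StepP x y k) ∧
    ∃ k < M, ¬ x.1.testBit (7 * k + 5) = true ∧ y.1.testBit (7 * k + 5) = true

/-- A step keeps every true `□ₚ`-digit true and, by the strictness clause, makes a false one true,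
so the finite set of false `□ₚ`-digits shrinks strictly. -/
theorem AccP.wellFounded : WellFounded fun y x : World M V => AccP x y := by
  let b (x : World M V) : Finset ℕ := {k ∈ Finset.range M | ¬ x.1.testBit (7 * k + 5) = true}
  refine Subrelation.wf (r := InvImage (· < ·) fun x => (b x).card) ?_
    (InvImage.wf _ wellFounded_lt)
  rintro y x ⟨h, k, hk, hx, hy⟩
  refine Finset.card_lt_card ⟨fun j hj => ?_, fun hs => ?_⟩
  · simp only [b, Finset.mem_filter, Finset.mem_range] at hj ⊢
    exact ⟨hj.1, fun hxj => (h j hj.1).elim (fun h => h hxj) fun h => hj.2 h.1⟩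
  · have hkx : k ∈ b x := by simpa [b, hk] using hx
    have := hs hkx
    simp only [b, Finset.mem_filter] at this
    exact this.2 hy

/-- The valuation of the model coded by `V`. -/
def valuation (x : World M V) (n : ℕ) : Prop := x.1.testBit (7 * n) = true

theorem AccP.weak {x y : World M V} (h : AccP x y) {k : ℕ} (hk : k < M)
    (hx : x.1.testBit (7 * k + 5) = true) :
    y.1.testBit (7 * k + 5) = true ∧ y.1.testBit (7 * k + 6) = true :=
  (h.1 k hk).resolve_left (fun h => h hx)

theorem AccF.weak {x y : World M V} (h : AccF x y) {k : ℕ} (hk : k < M)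
    (hx : x.1.testBit (7 * k + 6) = true) : y.1.testBit (7 * k + 6) = true :=
  (h k hk).2.2.resolve_left (fun h => h hx)

/-- The `AccP`-successors of a world depend only on its `□ₚ`-digits, which `AccF` preserves in both
directions. This validates the first two interaction axioms. -/
theorem AccF.accP_iff {x y z : World M V} (h : AccF x y) : AccP x z ↔ AccP y z := by
  have h5 : ∀ k < M, (x.1.testBit (7 * k + 5) = true ↔ y.1.testBit (7 * k + 5) = true) :=
    fun k hk => (h k hk).1
  unfold AccP StepP
  refine and_congr (forall₂_congr fun k hk => ?_) (exists_congr fun k => and_congr_right fun hk => ?_)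
  · rw [h5 k hk]
  · rw [h5 k hk]

theorem IsModel.provable_forces (hV : IsModel M V) {A : Formula} (h : Provable A)
    (w : World M V) : Forces AccP AccF valuation w A := by
  refine h.forces ?_ AccP.wellFounded ?_ ?_ ?_ (fun x y z => AccF.accP_iff) ?_ w
  · rintro x y z hxy hyz
    refine ⟨fun k hk => or_iff_not_imp_left.2 fun hx => ?_, ?_⟩
    · exact hyz.weak hk (hxy.weak hk (not_not.1 hx)).1
    · obtain ⟨-, k, hk, hx, hy⟩ := hxy
      exact ⟨k, hk, hx, (hyz.weak hk hy).1⟩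
  · exact fun x k _ => ⟨Iff.rfl, Iff.rfl, (em _).symm⟩
  · intro x y z hxy hyz k hk
    refine ⟨(hxy k hk).1.trans (hyz k hk).1, (hxy k hk).2.1.trans (hyz k hk).2.1, ?_⟩
    exact or_iff_not_imp_left.2 fun hx => hyz.weak hk (hxy.weak hk (not_not.1 hx))
  · intro x y z hxy hxz
    -- Directedness: a final world `w` above `y` is also above `z`. If `z` has `□_f B`, coherence
    -- gives it `◇_f □_f B`; this digit is shared by `z`, `x`, `y` and `w`, and finality of `w`
    -- turns it into `□_f B`.
    obtain ⟨w, hw, hVw, hyw⟩ := ((hV y y.2.1).resolve_left (fun h => h y.2.2)).2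
    refine ⟨⟨w, hw, hVw⟩, fun k hk => (hyw k hk).1, fun k hk => ?_⟩
    have hF : z.1.testBit (7 * M + k) = true ↔ w.testBit (7 * M + k) = true :=
      (hxz k hk).2.1.symm.trans ((hxy k hk).2.1.trans (hyw k hk).1.2.1)
    refine ⟨(hxz k hk).1.symm.trans ((hxy k hk).1.trans (hyw k hk).1.1), hF, ?_⟩
    refine or_iff_not_imp_left.2 fun hz => (hyw k hk).2.resolve_left fun h => h (hF.1 ?_)
    have hc := (((hV z z.2.1).resolve_left (fun h => h z.2.2)).1 k hk).1.2.2.2.2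
    exact (hc.resolve_left hz).2
  · intro x y z hxy hyz
    refine ⟨fun k hk => or_iff_not_imp_left.2 fun hx => ?_, ?_⟩
    · have := hxy.weak hk (not_not.1 hx)
      exact ⟨(hyz k hk).1.1 this.1, hyz.weak hk this.2⟩
    · obtain ⟨-, k, hk, hx, hy⟩ := hxy
      exact ⟨k, hk, hx, (hyz k hk).1.1 hy⟩

/-- In a finite model, truth of a formula with a small code is given by the binary digit of the
world at that code. -/
theorem IsModel.forces_iff (hV : IsModel M V) (A : Formula) (hA : code A < 7 * M)
    (w : World M V) : Forces AccP AccF valuation w A ↔ w.1.testBit (code A) = true := by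
  have good (x : World M V) := ((hV x x.2.1).resolve_left (fun h => h x.2.2)).1
  induction A generalizing w with
  | var n => rfl
  | neg A ih =>
    simp only [code] at hA
    exact (not_congr (ih (by omega) w)).trans (good w (code A) (by omega)).1.1.symm
  | and A B ihA ihB =>
    simp only [code] at hA
    have h1 := Nat.left_le_pair (code A) (code B)
    have h2 := Nat.right_le_pair (code A) (code B)
    have hc := (good w (Nat.pair (code A) (code B)) (by omega)).1.2.1
    rw [Nat.unpair_pair] at hc
    exact (and_congr (ihA (by omega) w) (ihB (by omega) w)).trans hc.symm
  | or A B ihA ihB =>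
    simp only [code] at hA
    have h1 := Nat.left_le_pair (code A) (code B)
    have h2 := Nat.right_le_pair (code A) (code B)
    have hc := (good w (Nat.pair (code A) (code B)) (by omega)).1.2.2.1
    rw [Nat.unpair_pair] at hc
    exact (or_congr (ihA (by omega) w) (ihB (by omega) w)).trans hc.symm
  | imp A B ihA ihB =>
    simp only [code] at hA
    have h1 := Nat.left_le_pair (code A) (code B)
    have h2 := Nat.right_le_pair (code A) (code B)
    have hc := (good w (Nat.pair (code A) (code B)) (by omega)).1.2.2.2.1
    rw [Nat.unpair_pair] at hc
    exact (imp_congr (ihA (by omega) w) (ihB (by omega) w)).trans (imp_iff_not_or.trans hc.symm)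
  | boxP A ih =>
    simp only [code] at hA
    have hk : code A < M := by omega
    simp only [Forces, ih (by omega), code]
    refine ⟨fun h => (good w _ hk).2.2.resolve_right ?_, fun h u hu => ?_⟩
    · rintro ⟨y, hy, hVy, hyk, hy5, hs⟩
      -- The witness is a strict successor: were `□ₚ A` already true at `w`, then `□_f A`, and so
      -- `A`, would hold at `y`.
      refine hyk (h ⟨y, hy, hVy⟩ ⟨hs, code A, hk, fun h5 => ?_, hy5⟩)
      exact hyk (((good ⟨y, hy, hVy⟩ _ hk).1.2.2.2.2.resolve_left fun h => h
        ((hs _ hk).resolve_left fun h => h h5).2).1)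
    · exact ((good u _ hk).1.2.2.2.2.resolve_left fun h' => h' (hu.weak hk h).2).1
  | boxF A ih =>
    simp only [code] at hA
    have hk : code A < M := by omega
    simp only [Forces, ih (by omega), code]
    refine ⟨fun h => (good w _ hk).2.1.resolve_right ?_, fun h u hu => ?_⟩
    · rintro ⟨y, hy, hVy, hyk, hs⟩
      exact hyk (h ⟨y, hy, hVy⟩ hs)
    · exact ((good u _ hk).1.2.2.2.2.resolve_left fun h' => h' (hu.weak hk h)).1

theorem Provable.not_refutable {A : Formula} (h : Provable A) : ¬ Refutable (code A) := by
  rintro ⟨V, -, hV, x, hx, hVx, hn⟩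
  exact hn ((IsModel.forces_iff hV A (by omega) ⟨x, hx, hVx⟩).1 (IsModel.provable_forces hV h _))

end Model

end ModalPF
-- Maximal consistent sets
namespace ModalPF

open Formula

/-- Derivability from a set of hypotheses, without necessitation of hypotheses. -/
inductive Derives (Γ : Set Formula) : Formula → Prop
  | thm {A : Formula} (h : Provable A) : Derives Γ A
  | hyp {A : Formula} (h : A ∈ Γ) : Derives Γ A
  | mp {A B : Formula} (hAB : Derives Γ (imp A B)) (hA : Derives Γ A) : Derives Γ B

theorem Derives.taut {Γ : Set Formula} {A : Formula} (h : ∀ v, truth v A = true) : Derives Γ A :=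
  .thm (.taut A h)

/-- The deduction theorem. -/
theorem Derives.deduction {Γ : Set Formula} {A B : Formula} (h : Derives (insert A Γ) B) :
    Derives Γ (imp A B) := by
  induction h with
  | @thm B h =>
    exact .mp (.taut (A := imp B (imp A B)) fun v => by grind [truth]) (.thm h)
  | @hyp B h =>
    rcases h with rfl | h
    · exact .taut fun v => by grind [truth]
    · exact .mp (.taut (A := imp B (imp A B)) fun v => by grind [truth]) (.hyp h)
  | @mp B C _ _ ih1 ih2 =>
    exact .mp (.mp (.taut (A := imp (imp A (imp B C)) (imp (imp A B) (imp A C)))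
      fun v => by grind [truth]) ih1) ih2

theorem Derives.mono {Γ Δ : Set Formula} (hs : Γ ⊆ Δ) {A : Formula} (h : Derives Γ A) :
    Derives Δ A := by
  induction h with
  | thm h => exact .thm h
  | hyp h => exact .hyp (hs h)
  | mp _ _ ih1 ih2 => exact .mp ih1 ih2

theorem Derives.exists_of_sUnion {c : Set (Set Formula)} (hc : IsChain (· ⊆ ·) c)
    (hne : c.Nonempty) {A : Formula} (h : Derives (⋃₀ c) A) : ∃ Γ ∈ c, Derives Γ A := by
  induction h with
  | thm h => exact hne.imp fun Γ hΓ => ⟨hΓ, .thm h⟩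
  | hyp h => exact h.imp fun Γ hΓ => ⟨hΓ.1, .hyp hΓ.2⟩
  | mp _ _ ih1 ih2 =>
    obtain ⟨Γ, hΓ, h1⟩ := ih1
    obtain ⟨Δ, hΔ, h2⟩ := ih2
    rcases hc.total hΓ hΔ with h | h
    · exact ⟨Δ, hΔ, .mp (h1.mono h) h2⟩
    · exact ⟨Γ, hΓ, .mp h1 (h2.mono h)⟩

/-- Maximal consistent sets of formulas. -/
structure IsMaxConsistent (Γ : Set Formula) : Prop where
  mem_of_derives : ∀ {A}, Derives Γ A → A ∈ Γ
  neg_mem : ∀ {A}, neg A ∈ Γ ↔ A ∉ Γ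

/-- Lindenbaum's lemma. -/
theorem exists_isMaxConsistent {Γ : Set Formula} {C : Formula} (h : ¬ Derives Γ C) :
    ∃ Δ, IsMaxConsistent Δ ∧ Γ ⊆ Δ ∧ C ∉ Δ := by
  obtain ⟨Δ, hΓΔ, hΔ, hmax⟩ := zorn_subset_nonempty {Δ | ¬ Derives Δ C} (fun c hcs hc hne =>
    ⟨⋃₀ c, fun hd => by
      obtain ⟨Δ, hΔ, hd⟩ := hd.exists_of_sUnion hc hne
      exact hcs hΔ hd, fun s hs => Set.subset_sUnion_of_mem hs⟩) Γ h
  -- `Δ` is maximal among sets not deriving `C`, so adding any further formula makes `C` derivable.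
  have key {A : Formula} (hA : A ∉ Δ) : Derives Δ (imp A C) := by
    refine Derives.deduction (not_not.1 fun hn => hA ?_)
    exact hmax (y := insert A Δ) hn (Set.subset_insert A Δ) (Set.mem_insert A Δ)
  refine ⟨Δ, ⟨fun {A} hA => ?_, fun {A} => ⟨fun hn hA => hΔ ?_, fun hA => ?_⟩⟩, hΓΔ,
    fun hC => hΔ (.hyp hC)⟩
  · exact not_not.1 fun hn => hΔ (.mp (key hn) hA)
  · exact .mp (.mp (.taut (A := imp (neg A) (imp A C)) fun v => by grind [truth]) (.hyp hn))
      (.hyp hA)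
  · refine not_not.1 fun hn => hΔ ?_
    exact .mp (.mp (.taut (A := imp (imp (neg A) C) (imp (imp A C) C))
      fun v => by grind [truth]) (key hn)) (key hA)

theorem Provable.boxP_mono {A B : Formula} (h : Provable (imp A B)) :
    Provable (imp (boxP A) (boxP B)) :=
  .mp _ _ (.kP A B) (.necP _ h)

theorem Provable.trans {A B C : Formula} (h1 : Provable (imp A B)) (h2 : Provable (imp B C)) :
    Provable (imp A C) :=
  .mp _ _ (.mp _ _ (.taut (imp (imp A B) (imp (imp B C) (imp A C)))
    fun v => by grind [truth]) h1) h2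

/-- The usual derivation of transitivity from Löb's axiom, applied to `A ∧ □ₚ A`. -/
theorem Provable.fourP (A : Formula) : Provable (imp (boxP A) (boxP (boxP A))) := by
  let C := Formula.and A (boxP A)
  have h1 : Provable (imp (boxP C) (boxP A)) :=
    boxP_mono (.taut _ fun v => by grind [truth])
  have h2 : Provable (imp A (imp (boxP C) C)) :=
    .mp _ _ (.taut (imp (imp (boxP C) (boxP A)) (imp A (imp (boxP C) C)))
      fun v => by grind [truth]) h1
  exact h2.boxP_mono.trans ((Provable.loeb C).trans
    (boxP_mono (.taut _ fun v => by grind [truth])))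

namespace IsMaxConsistent

variable {Γ Δ : Set Formula} {A B : Formula}

theorem mem_of_provable (hΓ : IsMaxConsistent Γ) (h : Provable A) : A ∈ Γ :=
  hΓ.mem_of_derives (.thm h)

theorem mp (hΓ : IsMaxConsistent Γ) (h : imp A B ∈ Γ) (hA : A ∈ Γ) : B ∈ Γ :=
  hΓ.mem_of_derives (.mp (.hyp h) (.hyp hA))

theorem mem_of_imp (hΓ : IsMaxConsistent Γ) (h : Provable (imp A B)) (hA : A ∈ Γ) : B ∈ Γ :=
  hΓ.mp (hΓ.mem_of_provable h) hA

theorem imp_mem (hΓ : IsMaxConsistent Γ) : imp A B ∈ Γ ↔ A ∉ Γ ∨ B ∈ Γ := by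
  refine ⟨fun h => or_iff_not_imp_left.2 fun hA => hΓ.mp h (not_not.1 hA), ?_⟩
  rintro (h | h)
  · exact hΓ.mem_of_imp (A := neg A) (.taut _ fun v => by grind [truth]) (hΓ.neg_mem.2 h)
  · exact hΓ.mem_of_imp (A := B) (.taut _ fun v => by grind [truth]) h

theorem and_mem (hΓ : IsMaxConsistent Γ) : Formula.and A B ∈ Γ ↔ A ∈ Γ ∧ B ∈ Γ := by
  refine ⟨fun h => ⟨hΓ.mem_of_imp (.taut _ fun v => by grind [truth]) h,
    hΓ.mem_of_imp (.taut _ fun v => by grind [truth]) h⟩, fun h => ?_⟩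
  exact hΓ.mp (hΓ.mem_of_imp (A := A) (.taut _ fun v => by grind [truth]) h.1) h.2

theorem or_mem (hΓ : IsMaxConsistent Γ) : Formula.or A B ∈ Γ ↔ A ∈ Γ ∨ B ∈ Γ := by
  have h : Formula.or A B ∈ Γ ↔ imp (neg A) B ∈ Γ :=
    ⟨hΓ.mem_of_imp (.taut _ fun v => by grind [truth]),
      hΓ.mem_of_imp (.taut _ fun v => by grind [truth])⟩
  rw [h, hΓ.imp_mem, hΓ.neg_mem, not_not]

theorem boxF_mem_of_derives (hΓ : IsMaxConsistent Γ) (h : Derives {B | boxF B ∈ Γ} A) :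
    boxF A ∈ Γ := by
  induction h with
  | thm h => exact hΓ.mem_of_provable (.necF _ h)
  | hyp h => exact h
  | mp _ _ ih1 ih2 => exact hΓ.mp (hΓ.mem_of_imp (.kF _ _) ih1) ih2

theorem boxP_mem_of_derives (hΓ : IsMaxConsistent Γ) (h : Derives {B | boxP B ∈ Γ} A) :
    boxP A ∈ Γ := by
  induction h with
  | thm h => exact hΓ.mem_of_provable (.necP _ h)
  | hyp h => exact h
  | mp _ _ ih1 ih2 => exact hΓ.mp (hΓ.mem_of_imp (.kP _ _) ih1) ih2

/-- The canonical accessibility relation for `□_f`. -/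
def CanonF (Γ Δ : Set Formula) : Prop := ∀ B, boxF B ∈ Γ → B ∈ Δ

theorem exists_canonF (hΓ : IsMaxConsistent Γ) (h : boxF A ∉ Γ) :
    ∃ Δ, IsMaxConsistent Δ ∧ CanonF Γ Δ ∧ A ∉ Δ :=
  exists_isMaxConsistent fun hd => h (hΓ.boxF_mem_of_derives hd)

/-- Were `A` derivable from `□ₚ A` and the formulas boxed in `Γ`, Löb's axiom would put `□ₚ A` into
`Γ`. Having `□ₚ A` in `Δ` but not in `Γ` makes the step strict. -/
theorem exists_canonP (hΓ : IsMaxConsistent Γ) (h : boxP A ∉ Γ) :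
    ∃ Δ, IsMaxConsistent Δ ∧ (∀ B, boxP B ∈ Γ → boxP B ∈ Δ ∧ boxF B ∈ Δ) ∧
      boxP A ∈ Δ ∧ A ∉ Δ := by
  obtain ⟨Δ, hΔ, hs, hA⟩ :=
    exists_isMaxConsistent (Γ := insert (boxP A) {B | boxP B ∈ Γ}) (C := A) fun hd =>
      h (hΓ.mem_of_imp (.loeb A) (hΓ.boxP_mem_of_derives hd.deduction))
  exact ⟨Δ, hΔ, fun B hB => ⟨hs (Or.inr (hΓ.mem_of_imp (.fourP B) hB)),
    hs (Or.inr (hΓ.mem_of_imp (.boxPboxPboxF B) hB))⟩, hs (Or.inl rfl), hA⟩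

theorem CanonF.trans {Θ : Set Formula} (hΓ : IsMaxConsistent Γ) (h1 : CanonF Γ Δ)
    (h2 : CanonF Δ Θ) : CanonF Γ Θ :=
  fun B hB => h2 B (h1 _ (hΓ.mem_of_imp (.fourF B) hB))

theorem diaF_mem (hΓ : IsMaxConsistent Γ) :
    diaF A ∈ Γ ↔ ∃ Δ, IsMaxConsistent Δ ∧ CanonF Γ Δ ∧ A ∈ Δ := by
  rw [diaF, hΓ.neg_mem]
  constructor
  · intro h
    obtain ⟨Δ, hΔ, hs, hA⟩ := hΓ.exists_canonF h
    exact ⟨Δ, hΔ, hs, not_not.1 fun hn => hA (hΔ.neg_mem.2 hn)⟩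
  · rintro ⟨Δ, hΔ, hs, hA⟩ h
    exact hΔ.neg_mem.1 (hs _ h) hA

/-- Upwards this is the `.2` axiom for `□_f A`, after rewriting `□_f A` as `□_f □_f A`; downwards it
is transitivity. -/
theorem diaF_boxF_mem_iff (hΓ : IsMaxConsistent Γ) (hΔ : IsMaxConsistent Δ) (h : CanonF Γ Δ) :
    diaF (boxF A) ∈ Γ ↔ diaF (boxF A) ∈ Δ := by
  refine ⟨fun hA => h _ (hΓ.mem_of_imp (.dotTwoF (boxF A)) ?_), fun hA => ?_⟩
  · obtain ⟨Θ, hΘ, hs, hm⟩ := hΓ.diaF_mem.1 hA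
    exact hΓ.diaF_mem.2 ⟨Θ, hΘ, hs, hΘ.mem_of_imp (.fourF A) hm⟩
  · obtain ⟨Θ, hΘ, hs, hm⟩ := hΔ.diaF_mem.1 hA
    exact hΓ.diaF_mem.2 ⟨Θ, hΘ, h.trans hΓ hs, hm⟩

/-- Upwards and downwards correspond to the interaction axioms for `□ₚ` and `◇ₚ`; the double
negation comes from `◇ₚ` being an abbreviation. -/
theorem boxP_mem_iff (hΓ : IsMaxConsistent Γ) (hΔ : IsMaxConsistent Δ) (h : CanonF Γ Δ) :
    boxP A ∈ Γ ↔ boxP A ∈ Δ := by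
  have hnn {Θ : Set Formula} (hΘ : IsMaxConsistent Θ) :
      boxP A ∈ Θ ↔ boxP (neg (neg A)) ∈ Θ :=
    ⟨hΘ.mem_of_imp (.boxP_mono (.taut _ fun v => by grind [truth])),
      hΘ.mem_of_imp (.boxP_mono (.taut _ fun v => by grind [truth]))⟩
  refine ⟨fun hA => h _ (hΓ.mem_of_imp (.boxPboxF A) hA), fun hA => ?_⟩
  rw [hnn hΓ]
  rw [hnn hΔ] at hA
  refine not_not.1 fun hn => ?_
  exact hΔ.neg_mem.1 (h _ (hΓ.mem_of_imp (.diaPboxF (neg A)) (hΓ.neg_mem.2 hn))) hA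

theorem boxF_mem_of_canonF (hΓ : IsMaxConsistent Γ) (h : CanonF Γ Δ) (hA : boxF A ∈ Γ) :
    boxF A ∈ Δ :=
  h _ (hΓ.mem_of_imp (.fourF A) hA)

theorem canonF_refl (hΓ : IsMaxConsistent Γ) : CanonF Γ Γ :=
  fun B hB => hΓ.mem_of_imp (.tF B) hB

/-- Possibly settled formulas are closed under modus ponens: settle the implication first; its
antecedent remains possibly settled there and can be settled next. -/
theorem diaF_boxF_mem_of_derives (hΓ : IsMaxConsistent Γ)
    (h : Derives ({B | boxF B ∈ Γ} ∪ Set.image boxF {B | diaF (boxF B) ∈ Γ}) A) :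
    diaF (boxF A) ∈ Γ := by
  induction h with
  | thm h => exact hΓ.diaF_mem.2 ⟨Γ, hΓ, hΓ.canonF_refl, hΓ.mem_of_provable (.necF _ h)⟩
  | hyp h =>
    rcases h with h | ⟨B, h, rfl⟩
    · exact hΓ.diaF_mem.2 ⟨Γ, hΓ, hΓ.canonF_refl, h⟩
    · obtain ⟨Δ, hΔ, hs, hB⟩ := hΓ.diaF_mem.1 h
      exact hΓ.diaF_mem.2 ⟨Δ, hΔ, hs, hΔ.mem_of_imp (.fourF B) hB⟩
  | mp _ _ ih1 ih2 =>
    obtain ⟨Δ, hΔ, h1, hm1⟩ := hΓ.diaF_mem.1 ih1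
    rw [hΓ.diaF_boxF_mem_iff hΔ h1] at ih2
    obtain ⟨Θ, hΘ, h2, hm2⟩ := hΔ.diaF_mem.1 ih2
    exact hΓ.diaF_mem.2 ⟨Θ, hΘ, h1.trans hΓ h2,
      hΘ.mp (hΘ.mem_of_imp (.kF _ _) (hΔ.boxF_mem_of_canonF h2 hm1)) hm2⟩

/-- Every maximal consistent set sees one in which every possibly settled `□_f`-formula is
settled. -/
theorem exists_final (hΓ : IsMaxConsistent Γ) :
    ∃ Δ, IsMaxConsistent Δ ∧ CanonF Γ Δ ∧ ∀ B, diaF (boxF B) ∈ Γ → boxF B ∈ Δ := by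
  obtain ⟨Δ, hΔ, hs, -⟩ := exists_isMaxConsistent
    (Γ := {B | boxF B ∈ Γ} ∪ Set.image boxF {B | diaF (boxF B) ∈ Γ})
    -- A contradiction: if it were derivable, some successor of `Γ` would contain `□_f` of it,
    -- against reflexivity.
    (C := neg (imp (var 0) (var 0))) fun hd => by
      obtain ⟨Δ, hΔ, -, hn⟩ := hΓ.diaF_mem.1 (hΓ.diaF_boxF_mem_of_derives hd)
      exact hΔ.neg_mem.1 (hΔ.mem_of_imp (.tF _) hn)
        (hΔ.mem_of_provable (.taut _ fun v => by grind [truth]))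
  exact ⟨Δ, hΔ, fun B hB => hs (Or.inl hB), fun B hB => hs (Or.inr ⟨B, hB, rfl⟩)⟩

end IsMaxConsistent

/-! ### The finite canonical model -/

/-- The formula with code `n`. -/
noncomputable def formulaOf (n : ℕ) : Formula := Denumerable.ofNat Formula n

theorem code_formulaOf (n : ℕ) : code (formulaOf n) = n :=
  Denumerable.encode_ofNat (α := Formula) n

theorem formulaOf_code (A : Formula) : formulaOf (code A) = A :=
  code_injective (code_formulaOf _)

theorem formulaOf_neg (k : ℕ) : formulaOf (7 * k + 1) = neg (formulaOf k) :=
  code_injective (by simp only [code, code_formulaOf])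

theorem formulaOf_and (k : ℕ) : formulaOf (7 * k + 2) =
    Formula.and (formulaOf k.unpair.1) (formulaOf k.unpair.2) :=
  code_injective (by simp only [code, code_formulaOf, Nat.pair_unpair])

theorem formulaOf_or (k : ℕ) : formulaOf (7 * k + 3) =
    Formula.or (formulaOf k.unpair.1) (formulaOf k.unpair.2) :=
  code_injective (by simp only [code, code_formulaOf, Nat.pair_unpair])

theorem formulaOf_imp (k : ℕ) : formulaOf (7 * k + 4) =
    imp (formulaOf k.unpair.1) (formulaOf k.unpair.2) :=
  code_injective (by simp only [code, code_formulaOf, Nat.pair_unpair])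

theorem formulaOf_boxP (k : ℕ) : formulaOf (7 * k + 5) = boxP (formulaOf k) :=
  code_injective (by simp only [code, code_formulaOf])

theorem formulaOf_boxF (k : ℕ) : formulaOf (7 * k + 6) = boxF (formulaOf k) :=
  code_injective (by simp only [code, code_formulaOf])

open Classical in
/-- The world coding the restriction of `Γ` to formulas with code below `7 * M`. -/
noncomputable def typeOf (M : ℕ) (Γ : Set Formula) : ℕ :=
  Nat.ofBits fun j : Fin (8 * M) => decide
    (if j.1 < 7 * M then formulaOf j ∈ Γ else diaF (boxF (formulaOf (j - 7 * M))) ∈ Γ)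

section TypeOf

variable {M : ℕ} {Γ Δ : Set Formula}

theorem typeOf_lt : typeOf M Γ < 2 ^ (8 * M) := Nat.ofBits_lt_two_pow _

open Classical in
theorem testBit_typeOf {j : ℕ} (hj : j < 7 * M) :
    (typeOf M Γ).testBit j = true ↔ formulaOf j ∈ Γ := by
  rw [typeOf, Nat.testBit_ofBits_lt _ _ (by omega), decide_eq_true_iff, if_pos hj]

open Classical in
theorem testBit_typeOf_add {k : ℕ} (hk : k < M) :
    (typeOf M Γ).testBit (7 * M + k) = true ↔ diaF (boxF (formulaOf k)) ∈ Γ := by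
  rw [typeOf, Nat.testBit_ofBits_lt _ _ (by omega), decide_eq_true_iff, if_neg (by simp),
    Nat.add_sub_cancel_left]

theorem testBit_typeOf_boxP {k : ℕ} (hk : k < M) :
    (typeOf M Γ).testBit (7 * k + 5) = true ↔ boxP (formulaOf k) ∈ Γ := by
  rw [testBit_typeOf (by omega), formulaOf_boxP]

theorem testBit_typeOf_boxF {k : ℕ} (hk : k < M) :
    (typeOf M Γ).testBit (7 * k + 6) = true ↔ boxF (formulaOf k) ∈ Γ := by
  rw [testBit_typeOf (by omega), formulaOf_boxF]

theorem coherent_typeOf (hΓ : IsMaxConsistent Γ) {k : ℕ} (hk : k < M) :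
    Coherent M (typeOf M Γ) k := by
  have h1 := k.unpair_left_le
  have h2 := k.unpair_right_le
  unfold Coherent
  rw [testBit_typeOf_add hk, testBit_typeOf_boxF hk, testBit_typeOf (by omega),
    testBit_typeOf (by omega), testBit_typeOf (by omega), testBit_typeOf (by omega),
    testBit_typeOf (by omega), testBit_typeOf (by omega), testBit_typeOf (by omega),
    formulaOf_neg, formulaOf_and, formulaOf_or, formulaOf_imp]
  refine ⟨hΓ.neg_mem, hΓ.and_mem, hΓ.or_mem, hΓ.imp_mem, or_iff_not_imp_left.2 fun h => ?_⟩
  rw [not_not] at h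
  exact ⟨hΓ.mem_of_imp (.tF _) h, hΓ.diaF_mem.2 ⟨Γ, hΓ, hΓ.canonF_refl, h⟩⟩

theorem stepF_typeOf (hΓ : IsMaxConsistent Γ) (hΔ : IsMaxConsistent Δ)
    (h : IsMaxConsistent.CanonF Γ Δ) {k : ℕ} (hk : k < M) :
    StepF M (typeOf M Γ) (typeOf M Δ) k := by
  unfold StepF
  rw [testBit_typeOf_add hk, testBit_typeOf_boxF hk, testBit_typeOf_boxP hk,
    testBit_typeOf_add hk, testBit_typeOf_boxF hk, testBit_typeOf_boxP hk]
  exact ⟨hΓ.boxP_mem_iff hΔ h, hΓ.diaF_boxF_mem_iff hΔ h,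
    or_iff_not_imp_left.2 fun hA => hΓ.boxF_mem_of_canonF h (not_not.1 hA)⟩

open Classical in
/-- The code of the set of all worlds `typeOf M Γ` with `Γ` maximal consistent. -/
noncomputable def canonicalModel (M : ℕ) : ℕ :=
  Nat.ofBits fun x : Fin (2 ^ (8 * M)) => decide (∃ Γ, IsMaxConsistent Γ ∧ typeOf M Γ = x)

open Classical in
theorem testBit_canonicalModel {x : ℕ} (hx : x < 2 ^ (8 * M)) :
    (canonicalModel M).testBit x = true ↔ ∃ Γ, IsMaxConsistent Γ ∧ typeOf M Γ = x := by
  rw [canonicalModel, Nat.testBit_ofBits_lt _ _ hx, decide_eq_true_iff]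

theorem testBit_canonicalModel_typeOf (hΓ : IsMaxConsistent Γ) :
    (canonicalModel M).testBit (typeOf M Γ) = true :=
  (testBit_canonicalModel typeOf_lt).2 ⟨Γ, hΓ, rfl⟩

/-- The witnesses are the types of the sets from `exists_canonF`, `exists_canonP` and
`exists_final`; restricting to digits preserves the required relations. -/
theorem isModel_canonicalModel (M : ℕ) : IsModel M (canonicalModel M) := by
  refine fun x hx => or_iff_not_imp_left.2 fun hV => ?_
  obtain ⟨Γ, hΓ, rfl⟩ := (testBit_canonicalModel hx).1 (not_not.1 hV)
  refine ⟨fun k hk => ⟨coherent_typeOf hΓ hk, or_iff_not_imp_left.2 fun h => ?_,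
    or_iff_not_imp_left.2 fun h => ?_⟩, ?_⟩
  · rw [testBit_typeOf_boxF hk] at h
    obtain ⟨Δ, hΔ, hs, hn⟩ := hΓ.exists_canonF h
    refine ⟨typeOf M Δ, typeOf_lt, testBit_canonicalModel_typeOf hΔ, ?_,
      fun j hj => stepF_typeOf hΓ hΔ hs hj⟩
    rwa [testBit_typeOf (by omega)]
  · rw [testBit_typeOf_boxP hk] at h
    obtain ⟨Δ, hΔ, hs, hb, hn⟩ := hΓ.exists_canonP h
    refine ⟨typeOf M Δ, typeOf_lt, testBit_canonicalModel_typeOf hΔ, ?_,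
      (testBit_typeOf_boxP hk).2 hb, fun j hj => or_iff_not_imp_left.2 fun hB => ?_⟩
    · rwa [testBit_typeOf (by omega)]
    · rw [testBit_typeOf_boxP hj, testBit_typeOf_boxF hj]
      exact hs _ ((testBit_typeOf_boxP hj).1 (not_not.1 hB))
  · obtain ⟨Δ, hΔ, hs, hf⟩ := hΓ.exists_final
    refine ⟨typeOf M Δ, typeOf_lt, testBit_canonicalModel_typeOf hΔ,
      fun j hj => ⟨stepF_typeOf hΓ hΔ hs hj, or_iff_not_imp_left.2 fun hB => ?_⟩⟩
    -- The digit is read at `Δ`, whereas finality refers to `Γ`; the two agree along `CanonF`.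
    rw [not_not, testBit_typeOf_add hj, ← hΓ.diaF_boxF_mem_iff hΔ hs] at hB
    exact (testBit_typeOf_boxF hj).2 (hf _ hB)

end TypeOf

theorem Derives.provable {A : Formula} (h : Derives ∅ A) : Provable A := by
  induction h with
  | thm h => exact h
  | hyp h => exact h.elim
  | mp _ _ ih1 ih2 => exact .mp _ _ ih1 ih2

theorem refutable_of_not_provable {A : Formula} (h : ¬ Provable A) : Refutable (code A) := by
  obtain ⟨Γ, hΓ, -, hA⟩ := exists_isMaxConsistent (Γ := ∅) (C := A) fun hd => h hd.provable
  refine ⟨canonicalModel _, Nat.ofBits_lt_two_pow _, isModel_canonicalModel _,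
    typeOf (code A + 1) Γ, typeOf_lt, testBit_canonicalModel_typeOf hΓ, ?_⟩
  rwa [testBit_typeOf (by omega), formulaOf_code]

end ModalPF

theorem mainTheorem5 : ComputablePred (fun A : ModalPF.Formula => ModalPF.Provable A) := by
  have h : PrimrecPred fun A : ModalPF.Formula => ¬ ModalPF.Refutable (Encodable.encode A) :=
    (ModalPF.primrecPred_refutable.comp Primrec.encode).not
  refine h.computablePred.of_eq fun A => ?_
  exact ⟨fun h => not_not.1 fun hn => h (ModalPF.refutable_of_not_provable hn),
    fun h => h.not_refutable⟩
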